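/- Let $\mathcal X,\mathcal Y$ be finite sets, let $f\subseteq\mathcal X\times\mathcal Y\times\mathcal Z$ be a relation, and let $\mu=\mu_X\times\mu_Y$ be a product probability distribution on $\mathcal X\times\mathcal Y$. Consider a two-way classical private-coin protocol $\mathcal P$ with finitely many messages: Alice, who gets $x\in\mathcal X$, sends the first message, the players alternate, each message is a bit string determined by the sender's input, the sender's private coins and the previous messages, and Bob, who gets $y\in\mathcal Y$, computes the answer $z\in\mathcal Z$ from $y$, his private coins and all messages. Alice's and Bob's coins range over finite sets, have arbitrary distributions, and are independent of each other and of the inputs. The distributional error of a protocol under $\mu$ is the probability, over $(X,Y)\sim\mu$ and the coins, that the answer $z$ satisfies $(X,Y,z)\notin f$. Let $M$ be the complete transcript of the messages of $\mathcal P$ when $(X,Y)\sim\mu$, and let $I(X:M)=H(X)+H(M)-H(X,M)$ and $I(Y:M)$ denote mutual information in bits. There are absolute constants $C_1,C_2>0$ such that the following holds for all such $f$, $\mu$, $\mathcal P$. Let $\epsilon\in(0,1/2)$ and $\tilde\delta>0$ with $\epsilon+\tilde\delta<1/2$. Suppose that $\mathcal P$ has distributional error at most $\epsilon$ under $\mu$,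 and that its privacy losses satisfy $I(X:M)\le k_a$ and $I(Y:M)\le k_b$, where $k_a,k_b\in\mathbb R$. Then there is a one-way public-coin protocol $\tilde{\mathcal P}$, with a single message from Alice to Bob, after which Bob computes the answer, such that: 1. the length in bits of Alice's message in $\tilde{\mathcal P}$ (for all inputs and coins) is at most $$C_1\cdot\frac{\log_2(1/\tilde\delta)}{\tilde\delta^{3}}\cdot(k_a+1)\cdot 2^{C_2 (k_b+1)/\tilde\delta^{2}};$$ 2. the distributional error of $\tilde{\mathcal P}$ under $\mu$ is at most $\epsilon+\tilde\delta$. There is also a deterministic one-way protocol from Alice to Bob with properties 1 and 2. -/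

import Mathlib

namespace CommComplexity

/-! Probability distributions on a finite type `Ω` are weight functions `p ∈ stdSimplex ℝ Ω`. -/

section Probability

variable {Ω α β : Type*} [Fintype Ω]

open Classical in
/-- Probability of the event `E` under the weights `p`. -/
noncomputable def prob (p : Ω → ℝ) (E : Ω → Prop) : ℝ :=
  ∑ ω with E ω, p ω

open Classical in
/-- Shannon entropy, in bits, of the random variable `V` on the finite space `(Ω, p)`. -/
noncomputable def entropy (p : Ω → ℝ) (V : Ω → α) : ℝ :=
  ∑ v ∈ Finset.univ.image V, Real.negMulLog (prob p (fun ω => V ω = v)) / Real.log 2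

/-- Mutual information `I(V : W) = H(V) + H(W) - H(V, W)`, in bits. -/
noncomputable def mutualInfo (p : Ω → ℝ) (V : Ω → α) (W : Ω → β) : ℝ :=
  entropy p V + entropy p W - entropy p (fun ω => (V ω, W ω))

end Probability

/-- A message is a (possibly empty) bit string. -/
abbrev Message : Type := List Bool

/-- A transcript is the list of the messages sent so far, in order. -/
abbrev Transcript : Type := List Message

/-- A two-way private-coin protocol in which Alice sends the first message, the players alternate,
and Bob computes the answer. Alice's coins `a : RA` and Bob's coins `b : RB` are drawn
independently of each other and of the inputs. The next message of a player depends on the player's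
own input, own coins, and the messages sent so far. -/
structure PrivateCoinProtocol (X Y Z RA RB : Type*) [Fintype RA] [Fintype RB] where
  /-- the number of messages -/
  rounds : ℕ
  /-- the distribution of Alice's private coins -/
  aliceCoins : RA → ℝ
  aliceCoins_mem : aliceCoins ∈ stdSimplex ℝ RA
  /-- the distribution of Bob's private coins -/
  bobCoins : RB → ℝ
  bobCoins_mem : bobCoins ∈ stdSimplex ℝ RB
  aliceMsg : X → RA → Transcript → Message
  bobMsg : Y → RB → Transcript → Message
  output : Y → RB → Transcript → Z

namespace PrivateCoinProtocol

variable {X Y Z RA RB : Type*} [Fintype X] [Fintype Y] [Fintype RA] [Fintype RB]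

/-- The transcript after `i` messages, on inputs `x`, `y` and private coins `a`, `b`. -/
def transcriptUpTo (P : PrivateCoinProtocol X Y Z RA RB) (x : X) (y : Y) (a : RA) (b : RB) :
    ℕ → Transcript
  | 0 => []
  | i + 1 =>
    let t := P.transcriptUpTo x y a b i
    t ++ [if Even i then P.aliceMsg x a t else P.bobMsg y b t]

/-- The complete transcript of a run. -/
def transcript (P : PrivateCoinProtocol X Y Z RA RB) (ω : X × Y × RA × RB) : Transcript :=
  P.transcriptUpTo ω.1 ω.2.1 ω.2.2.1 ω.2.2.2 P.rounds

/-- Bob's answer at the end of a run. -/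
def answer (P : PrivateCoinProtocol X Y Z RA RB) (ω : X × Y × RA × RB) : Z :=
  P.output ω.2.1 ω.2.2.2 (P.transcript ω)

/-- The distribution of inputs and private coins when the inputs are drawn from `μX × μY`. -/
def runDist (P : PrivateCoinProtocol X Y Z RA RB) (μX : X → ℝ) (μY : Y → ℝ) :
    X × Y × RA × RB → ℝ :=
  fun ω => μX ω.1 * μY ω.2.1 * (P.aliceCoins ω.2.2.1 * P.bobCoins ω.2.2.2)

/-- The distributional error for the relation `f` under `μX × μY`, averaged over inputs and
coins. -/
noncomputable def error (P : PrivateCoinProtocol X Y Z RA RB) (f : Set (X × Y × Z))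
    (μX : X → ℝ) (μY : Y → ℝ) : ℝ :=
  prob (P.runDist μX μY) (fun ω => (ω.1, ω.2.1, P.answer ω) ∉ f)

/-- The privacy loss `I(X : M)` from Alice to Bob under `μX × μY`, where `M` is the complete
transcript. -/
noncomputable def privacyLossAlice (P : PrivateCoinProtocol X Y Z RA RB)
    (μX : X → ℝ) (μY : Y → ℝ) : ℝ :=
  mutualInfo (P.runDist μX μY) (fun ω => ω.1) P.transcript

/-- The privacy loss `I(Y : M)` from Bob to Alice under `μX × μY`, where `M` is the complete
transcript. -/
noncomputable def privacyLossBob (P : PrivateCoinProtocol X Y Z RA RB)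
    (μX : X → ℝ) (μY : Y → ℝ) : ℝ :=
  mutualInfo (P.runDist μX μY) (fun ω => ω.2.1) P.transcript

end PrivateCoinProtocol

/-- A one-way public-coin protocol: the coins `r : R`, independent of the inputs, are seen by both
players, Alice sends a single message of `cost` bits and Bob computes the answer. -/
structure OneWayPublicCoinProtocol (X Y Z R : Type*) [Fintype R] where
  /-- the number of bits that Alice sends (for all inputs and coins) -/
  cost : ℕ
  /-- the distribution of the public coins -/
  coins : R → ℝ
  coins_mem : coins ∈ stdSimplex ℝ R
  msg : X → R → (Fin cost → Bool)
  output : Y → R → (Fin cost → Bool) → Z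

/-- The distributional error for the relation `f` under `μX × μY`, averaged over inputs and
coins. -/
noncomputable def OneWayPublicCoinProtocol.error {X Y Z R : Type*} [Fintype X] [Fintype Y]
    [Fintype R] (Q : OneWayPublicCoinProtocol X Y Z R) (f : Set (X × Y × Z))
    (μX : X → ℝ) (μY : Y → ℝ) : ℝ :=
  prob (fun ω : X × Y × R => μX ω.1 * μY ω.2.1 * Q.coins ω.2.2)
    (fun ω => (ω.1, ω.2.1, Q.output ω.2.1 ω.2.2 (Q.msg ω.1 ω.2.2)) ∉ f)

/-- A one-way deterministic protocol: Alice sends a single message of `cost` bits, determined by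
her input, and Bob computes the answer. -/
structure OneWayDetProtocol (X Y Z : Type*) where
  /-- the number of bits that Alice sends -/
  cost : ℕ
  msg : X → (Fin cost → Bool)
  output : Y → (Fin cost → Bool) → Z

/-- The distributional error for the relation `f` under `μX × μY`. -/
noncomputable def OneWayDetProtocol.error {X Y Z : Type*} [Fintype X] [Fintype Y]
    (Q : OneWayDetProtocol X Y Z) (f : Set (X × Y × Z)) (μX : X → ℝ) (μY : Y → ℝ) : ℝ :=
  prob (fun ω : X × Y => μX ω.1 * μY ω.2)
    (fun ω => (ω.1, ω.2, Q.output ω.2 (Q.msg ω.1)) ∉ f)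

end CommComplexity

/-! The runs with a fixed transcript `m` form a rectangle, so given the inputs `m` has probability
`A x m * B y m`: Alice's weight times Bob's. Averaging each factor over its input gives a product
weight that both players know, and it can serve as a public sampling distribution for `m`. The
players correct it by rejection: Alice accepts `m` with probability `A x m / (2 ^ a * avg)` if this
ratio is at most one and never otherwise, Bob likewise with `2 ^ b`. Apart from the truncated part,
the first sample accepted by both is distributed like the real transcript.

Among `n * 2 ^ (a + b)` public samples Alice accepts about `n * 2 ^ b`. She sends the indices of
those, cut off at `n` times this number, and Bob takes the first one that he accepts too. Hence the
cost is exponential in `b` only and linear in `a`. The truncated part is a tail of a likelihood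
ratio; `mul_prob_lt_joint_le`, a Markov inequality for the information density, bounds it by `(I +
2) / a` for Alice and `(I + 2) / b` for Bob.

Bob's private coins are removed by `exists_answer` and the list of samples is fixed by averaging
(`exists_sample_list`), so the protocol is deterministic from the start. The analysis of rejection
sampling is `listExp_firstLoss_le`. -/

namespace CommComplexity

/-! ### Mutual information as an expectation, and tails of the information density. -/

section Information

variable {Ω α β : Type*} [Fintype Ω]

open Classical in
lemma prob_eq_sum_ite (p : Ω → ℝ) (E : Ω → Prop) :
    prob p E = ∑ ω, if E ω then p ω else 0 := by
  simp [prob, Finset.sum_filter]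

lemma prob_nonneg {p : Ω → ℝ} (hp : ∀ ω, 0 ≤ p ω) (E : Ω → Prop) : 0 ≤ prob p E :=
  Finset.sum_nonneg fun ω _ => hp ω

lemma le_prob_fiber {p : Ω → ℝ} (hp : ∀ ω, 0 ≤ p ω) (V : Ω → α) (ω : Ω) :
    p ω ≤ prob p (fun ω' => V ω' = V ω) := by
  classical
  exact Finset.single_le_sum (f := p) (fun i _ => hp i) (by simp)

lemma sum_image_prob_mul [DecidableEq α] (p : Ω → ℝ) (V : Ω → α) (h : α → ℝ) :
    ∑ v ∈ Finset.univ.image V, prob p (fun ω => V ω = v) * h v = ∑ ω, p ω * h (V ω) := by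
  rw [← Finset.sum_fiberwise_of_maps_to (s := Finset.univ) (t := Finset.univ.image V) (g := V)
    (fun ω _ => Finset.mem_image_of_mem V (Finset.mem_univ ω))]
  refine Finset.sum_congr rfl fun v _ => ?_
  rw [prob, Finset.sum_mul]
  refine Finset.sum_congr (by congr) fun ω hω => ?_
  rw [(Finset.mem_filter.mp hω).2]

/-- As expectations over the same space, the three entropies in `mutualInfo` combine pointwise into
one logarithm. -/
lemma entropy_eq_sum (p : Ω → ℝ) (V : Ω → α) :
    entropy p V = ∑ ω, p ω * (-Real.log (prob p (fun ω' => V ω' = V ω)) / Real.log 2) := by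
  classical
  rw [entropy, ← sum_image_prob_mul p V
    (fun v => -Real.log (prob p (fun ω' => V ω' = v)) / Real.log 2)]
  refine Finset.sum_congr (by congr) fun v _ => ?_
  rw [Real.negMulLog]
  ring

lemma sum_image_prob [DecidableEq α] {p : Ω → ℝ} (hp : p ∈ stdSimplex ℝ Ω) (V : Ω → α) :
    ∑ v ∈ Finset.univ.image V, prob p (fun ω => V ω = v) = 1 := by
  simpa [hp.2] using sum_image_prob_mul p V (fun _ => 1)

/-- The density of the joint distribution with respect to the product of the marginals, inverted. -/
noncomputable def invDensity (p : Ω → ℝ) (V : Ω → α) (W : Ω → β) (ω : Ω) : ℝ :=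
  prob p (fun ω' => V ω' = V ω) * prob p (fun ω' => W ω' = W ω) /
    prob p (fun ω' => (V ω', W ω') = (V ω, W ω))

/-- The joint weight cancels, leaving at most the mass that the product of the marginals gives to
the joint range. -/
lemma sum_mul_invDensity_le {p : Ω → ℝ} (hp : p ∈ stdSimplex ℝ Ω) (V : Ω → α) (W : Ω → β) :
    ∑ ω, p ω * invDensity p V W ω ≤ 1 := by
  classical
  have h := sum_image_prob_mul p (fun ω => (V ω, W ω))
    (fun q => prob p (fun ω' => V ω' = q.1) * prob p (fun ω' => W ω' = q.2) /
      prob p (fun ω' => (V ω', W ω') = q))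
  have e : ∑ ω, p ω * invDensity p V W ω = _ := h.symm
  calc ∑ ω, p ω * invDensity p V W ω ≤ ∑ q ∈ Finset.univ.image (fun ω => (V ω, W ω)),
        prob p (fun ω' => V ω' = q.1) * prob p (fun ω' => W ω' = q.2) := by
        rw [e]
        refine Finset.sum_le_sum fun q _ => ?_
        rcases (prob_nonneg hp.1 (fun ω' => (V ω', W ω') = q)).eq_or_lt with h0 | h0
        · rw [← h0, zero_mul]
          exact mul_nonneg (prob_nonneg hp.1 _) (prob_nonneg hp.1 _)
        · rw [mul_div_cancel₀ _ h0.ne']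
    _ ≤ ∑ q ∈ Finset.univ.image V ×ˢ Finset.univ.image W,
        prob p (fun ω' => V ω' = q.1) * prob p (fun ω' => W ω' = q.2) := by
        have hsub : Finset.univ.image (fun ω => (V ω, W ω)) ⊆
            Finset.univ.image V ×ˢ Finset.univ.image W := fun q hq => by
          obtain ⟨ω, -, rfl⟩ := Finset.mem_image.mp hq
          simp
        exact Finset.sum_le_sum_of_subset_of_nonneg hsub fun q _ _ =>
          mul_nonneg (prob_nonneg hp.1 _) (prob_nonneg hp.1 _)
    _ = 1 := by
        rw [Finset.sum_product]
        dsimp only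
        rw [← Finset.sum_mul_sum, sum_image_prob hp, sum_image_prob hp, one_mul]

lemma mutualInfo_eq_sum {p : Ω → ℝ} (hp : ∀ ω, 0 ≤ p ω) (V : Ω → α) (W : Ω → β) :
    mutualInfo p V W = ∑ ω, p ω * (-Real.log (invDensity p V W ω) / Real.log 2) := by
  rw [mutualInfo, entropy_eq_sum, entropy_eq_sum, entropy_eq_sum, ← Finset.sum_add_distrib,
    ← Finset.sum_sub_distrib]
  refine Finset.sum_congr rfl fun ω _ => ?_
  rcases (hp ω).eq_or_lt with h0 | h0
  · simp [← h0]
  · have h1 := h0.trans_le (le_prob_fiber hp V ω)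
    have h2 := h0.trans_le (le_prob_fiber hp W ω)
    have h3 := h0.trans_le (le_prob_fiber hp (fun ω => (V ω, W ω)) ω)
    rw [invDensity, Real.log_div (mul_pos h1 h2).ne' h3.ne', Real.log_mul h1.ne' h2.ne']
    ring

lemma invDensity_pos {p : Ω → ℝ} (hp : ∀ ω, 0 ≤ p ω) (V : Ω → α) (W : Ω → β) {ω : Ω}
    (h0 : 0 < p ω) : 0 < invDensity p V W ω :=
  div_pos (mul_pos (h0.trans_le (le_prob_fiber hp V ω)) (h0.trans_le (le_prob_fiber hp W ω)))
    (h0.trans_le (le_prob_fiber hp (fun ω => (V ω, W ω)) ω))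

lemma mutualInfo_nonneg {p : Ω → ℝ} (hp : p ∈ stdSimplex ℝ Ω) (V : Ω → α) (W : Ω → β) :
    0 ≤ mutualInfo p V W := by
  have hl : 0 < Real.log 2 := Real.log_pos one_lt_two
  rw [mutualInfo_eq_sum hp.1]
  have h : ∑ ω, p ω * ((1 - invDensity p V W ω) / Real.log 2) ≤
      ∑ ω, p ω * (-Real.log (invDensity p V W ω) / Real.log 2) := by
    refine Finset.sum_le_sum fun ω _ => ?_
    rcases (hp.1 ω).eq_or_lt with h0 | h0
    · simp [← h0]
    · have := Real.log_le_sub_one_of_pos (invDensity_pos hp.1 V W h0)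
      gcongr
      linarith
  refine le_trans ?_ h
  have e : ∑ ω, p ω * ((1 - invDensity p V W ω) / Real.log 2) =
      (1 - ∑ ω, p ω * invDensity p V W ω) / Real.log 2 := by
    rw [← hp.2, ← Finset.sum_sub_distrib, Finset.sum_div, hp.2]
    exact Finset.sum_congr rfl fun ω _ => by ring
  rw [e]
  exact div_nonneg (by linarith [sum_mul_invDensity_le hp V W]) hl.le

/-- The joint density exceeds `2 ^ c` with probability at most `(I(V : W) + 2) / c`. -/
lemma mul_prob_lt_joint_le {p : Ω → ℝ} (hp : p ∈ stdSimplex ℝ Ω) (V : Ω → α) (W : Ω → β) (c : ℕ) :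
    c * prob p (fun ω => 2 ^ c * (prob p (fun ω' => V ω' = V ω) * prob p (fun ω' => W ω' = W ω)) <
      prob p (fun ω' => (V ω', W ω') = (V ω, W ω))) ≤ mutualInfo p V W + 2 := by
  classical
  have hl : 0 < Real.log 2 := Real.log_pos one_lt_two
  have hl2 : 1 / Real.log 2 ≤ 2 := by
    rw [div_le_iff₀ hl]; linarith [Real.log_two_gt_d9]
  -- The information density may be negative. Adding `invDensity / log 2` makes it nonnegative,
  -- since `log d ≤ d - 1`, and costs at most `1 / log 2 ≤ 2` in expectation; Markov's inequality
  -- then applies.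
  have h : c * prob p (fun ω => 2 ^ c * (prob p (fun ω' => V ω' = V ω) *
      prob p (fun ω' => W ω' = W ω)) < prob p (fun ω' => (V ω', W ω') = (V ω, W ω))) ≤
      ∑ ω, (p ω * (-Real.log (invDensity p V W ω) / Real.log 2) +
        p ω * invDensity p V W ω * (1 / Real.log 2)) := by
    rw [prob_eq_sum_ite, Finset.mul_sum]
    refine Finset.sum_le_sum fun ω _ => ?_
    rcases (hp.1 ω).eq_or_lt with h0 | h0
    · simp [← h0]
    have hd := invDensity_pos hp.1 V W h0
    have key : p ω * (-Real.log (invDensity p V W ω) / Real.log 2) +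
        p ω * invDensity p V W ω * (1 / Real.log 2) =
        p ω * ((-Real.log (invDensity p V W ω) + invDensity p V W ω) / Real.log 2) := by ring
    rw [key]
    split_ifs with hE
    · have h3 := h0.trans_le (le_prob_fiber hp.1 (fun ω => (V ω, W ω)) ω)
      have hd2 : 2 ^ c * invDensity p V W ω ≤ 1 := by
        rw [invDensity, ← mul_div_assoc, div_le_one h3]
        exact hE.le
      have hlog := Real.log_nonpos (by positivity) hd2
      rw [Real.log_mul (by positivity) hd.ne', Real.log_pow] at hlog
      rw [mul_comm]
      gcongr
      rw [le_div_iff₀ hl]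
      linarith
    · rw [mul_zero]
      have := Real.log_le_sub_one_of_pos hd
      exact mul_nonneg h0.le (div_nonneg (by linarith) hl.le)
  rw [Finset.sum_add_distrib, ← mutualInfo_eq_sum hp.1, ← Finset.sum_mul] at h
  have h1 := sum_mul_invDensity_le hp V W
  have h2 : (∑ ω, p ω * invDensity p V W ω) * (1 / Real.log 2) ≤ 1 * (1 / Real.log 2) := by
    gcongr
  linarith

end Information

/-! ### Independent samples and rejection sampling. -/

section ListExpectation

variable {W : Type*} [Fintype W]

/-- Expectation of `F` over lists of `n` independent samples from the weights `π`. -/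
noncomputable def listExp (π : W → ℝ) : ℕ → (List W → ℝ) → ℝ
  | 0, F => F []
  | n + 1, F => ∑ w, π w * listExp π n (fun l => F (w :: l))

lemma exists_le_sum_mul {π : W → ℝ} (hπ : π ∈ stdSimplex ℝ W) (h : W → ℝ) :
    ∃ w, h w ≤ ∑ w, π w * h w := by
  by_contra! hc
  have hlt : ∑ w, π w * (∑ w, π w * h w) < ∑ w, π w * h w := by
    obtain ⟨w, -, hw⟩ : ∃ w ∈ Finset.univ, 0 < π w :=
      Finset.exists_lt_of_sum_lt (f := fun _ => (0 : ℝ)) (by simp [hπ.2])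
    exact Finset.sum_lt_sum (fun w _ => mul_le_mul_of_nonneg_left (hc w).le (hπ.1 w))
      ⟨w, Finset.mem_univ w, mul_lt_mul_of_pos_left (hc w) hw⟩
  rw [← Finset.sum_mul, hπ.2, one_mul] at hlt
  exact lt_irrefl _ hlt

lemma exists_le_listExp {π : W → ℝ} (hπ : π ∈ stdSimplex ℝ W) (n : ℕ) (F : List W → ℝ) :
    ∃ l : List W, l.length = n ∧ F l ≤ listExp π n F := by
  induction n generalizing F with
  | zero => exact ⟨[], rfl, le_rfl⟩
  | succ n ih =>
    obtain ⟨w, hw⟩ := exists_le_sum_mul hπ (fun w => listExp π n (fun l => F (w :: l)))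
    obtain ⟨l, hl, hF⟩ := ih (fun l => F (w :: l))
    exact ⟨w :: l, by simp [hl], hF.trans hw⟩

lemma listExp_add (π : W → ℝ) (n : ℕ) (F G : List W → ℝ) :
    listExp π n (fun l => F l + G l) = listExp π n F + listExp π n G := by
  induction n generalizing F G with
  | zero => rfl
  | succ n ih => simp [listExp, ih, mul_add, Finset.sum_add_distrib]

lemma listExp_const_mul (π : W → ℝ) (n : ℕ) (c : ℝ) (F : List W → ℝ) :
    listExp π n (fun l => c * F l) = c * listExp π n F := by
  induction n generalizing F with
  | zero => rfl
  | succ n ih => simp [listExp, ih, Finset.mul_sum, mul_left_comm]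

lemma listExp_sum {ι : Type*} (s : Finset ι) (π : W → ℝ) (n : ℕ) (F : ι → List W → ℝ) :
    listExp π n (fun l => ∑ i ∈ s, F i l) = ∑ i ∈ s, listExp π n (F i) := by
  induction n generalizing F with
  | zero => rfl
  | succ n ih => simp only [listExp, ih, Finset.mul_sum]; exact Finset.sum_comm

lemma listExp_const {π : W → ℝ} (hπ : ∑ w, π w = 1) (n : ℕ) (c : ℝ) :
    listExp π n (fun _ => c) = c := by
  induction n with
  | zero => rfl
  | succ n ih => simp [listExp, ih, ← Finset.sum_mul, hπ]

lemma listExp_countP {π : W → ℝ} (hπ : ∑ w, π w = 1) (acc : W → Bool) (n : ℕ) :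
    listExp π n (fun l => (l.countP acc : ℝ)) = n * ∑ w, if acc w then π w else 0 := by
  induction n with
  | zero => simp [listExp]
  | succ n ih =>
    have e : ∀ w, listExp π n (fun l => ((w :: l).countP acc : ℝ)) =
        n * (∑ w, if acc w then π w else 0) + if acc w then 1 else 0 := by
      intro w
      rw [← ih, ← listExp_const hπ n (if acc w then (1 : ℝ) else 0), ← listExp_add]
      congr 1
      funext l
      rw [List.countP_cons]
      push_cast
      rfl
    simp only [listExp, e, mul_add, Finset.sum_add_distrib, ← Finset.sum_mul, hπ]
    push_cast
    simp
    ring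

/-- The loss at the first accepted entry of a list, or `1` if there is none. -/
def firstLoss (acc : W → Bool) (g : W → ℝ) (l : List W) : ℝ :=
  (l.find? acc).elim 1 g

lemma listExp_firstLoss_succ {π : W → ℝ} (hπ : ∑ w, π w = 1) (acc : W → Bool) (g : W → ℝ) (n : ℕ) :
    listExp π (n + 1) (firstLoss acc g) = (∑ w, if acc w then π w * g w else 0) +
      (1 - ∑ w, if acc w then π w else 0) * listExp π n (firstLoss acc g) := by
  have e : ∀ w, π w * listExp π n (fun l => firstLoss acc g (w :: l)) =
      (if acc w then π w * g w else 0) +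
        (π w - if acc w then π w else 0) * listExp π n (firstLoss acc g) := by
    intro w
    cases hw : acc w
    · simp [firstLoss, hw]
      left; rfl
    · simp [firstLoss, hw, listExp_const hπ]
  simp only [listExp, e, Finset.sum_add_distrib, ← Finset.sum_mul, Finset.sum_sub_distrib, hπ]

/-- Bernoulli's inequality bounds the second factor by `(1 + s) ^ n`. This controls the chance that
no sample is accepted. -/
lemma one_sub_pow_mul_le_one {s : ℝ} (h0 : 0 ≤ s) (h1 : s ≤ 1) (n : ℕ) :
    (1 - s) ^ n * (1 + n * s) ≤ 1 := by
  calc (1 - s) ^ n * (1 + n * s) ≤ (1 - s) ^ n * (1 + s) ^ n := by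
        have := one_add_mul_le_pow (a := s) (by linarith) n
        have h2 : 0 ≤ (1 - s) ^ n := pow_nonneg (by linarith) n
        gcongr
    _ = (1 - s ^ 2) ^ n := by rw [← mul_pow]; ring
    _ ≤ 1 := pow_le_one₀ (by nlinarith) (by nlinarith)

/-- Rejection sampling: if the accepted part of `π`, scaled by `D`, has mass close to one, then
the first accepted sample has about the expected loss of the scaled accepted part. -/
lemma listExp_firstLoss_le {π : W → ℝ} (hπ : π ∈ stdSimplex ℝ W) (acc : W → Bool) {g : W → ℝ}
    (hg0 : ∀ w, 0 ≤ g w) (hg1 : ∀ w, g w ≤ 1) {D n : ℕ} (hn : 0 < n)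
    (hD : D * (∑ w, if acc w then π w else 0) ≤ 1) :
    listExp π (n * D) (firstLoss acc g) ≤ D * (∑ w, if acc w then π w * g w else 0) +
      2 * (1 - D * ∑ w, if acc w then π w else 0) + 1 / n := by
  set s := ∑ w, if acc w then π w else 0 with hs
  set q := ∑ w, if acc w then π w * g w else 0 with hq
  have hn' : (0 : ℝ) < n := by exact_mod_cast hn
  have hs0 : 0 ≤ s := Finset.sum_nonneg fun w _ => by split_ifs <;> simp [hπ.1 w]
  have hs1 : s ≤ 1 := by
    rw [← hπ.2]
    exact Finset.sum_le_sum fun w _ => by split_ifs <;> simp [hπ.1 w]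
  have hq0 : 0 ≤ q := Finset.sum_nonneg fun w _ => by
    split_ifs
    · exact mul_nonneg (hπ.1 w) (hg0 w)
    · exact le_rfl
  have hqs : q ≤ s := Finset.sum_le_sum fun w _ => by
    split_ifs
    · exact mul_le_of_le_one_right (hπ.1 w) (hg1 w)
    · exact le_rfl
  have he1 : ∀ n, listExp π n (firstLoss acc g) ≤ 1 := by
    intro n
    induction n with
    | zero => simp [listExp, firstLoss]
    | succ n ih =>
      rw [listExp_firstLoss_succ hπ.2]
      nlinarith
  -- The conditional loss is `q / s`, and failure costs `1` with probability `(1 - s) ^ n`;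
  -- multiplying by `s` avoids dividing by zero.
  have he : ∀ n, s * listExp π n (firstLoss acc g) ≤ q + s * (1 - s) ^ n := by
    intro n
    induction n with
    | zero => simp [listExp, firstLoss, hq0]
    | succ n ih =>
      rw [listExp_firstLoss_succ hπ.2, pow_succ]
      nlinarith
  have hDpos : (0 : ℝ) ≤ D := Nat.cast_nonneg D
  rcases hs0.eq_or_lt with h0 | h0
  · rw [← h0]
    have := he1 (n * D)
    have h2 : (0 : ℝ) ≤ 1 / n := by positivity
    nlinarith [mul_nonneg hDpos hq0]
  rcases Nat.eq_zero_or_pos D with rfl | hD0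
  · have := he1 (n * 0)
    have h2 : (0 : ℝ) ≤ 1 / n := by positivity
    simp only [Nat.cast_zero, zero_mul, sub_zero]
    linarith
  have hD0' : (0 : ℝ) < D := by exact_mod_cast hD0
  set σ := D * s with hσ
  have hσ0 : 0 < σ := mul_pos hD0' h0
  -- The left side is at most `1 / (1 + n * σ)`.
  have hpow : (1 - s) ^ (n * D) ≤ (1 - σ) + 1 / n := by
    have h1 := one_sub_pow_mul_le_one hs0 hs1 (n * D)
    push_cast at h1
    have h2 : (1 : ℝ) ≤ ((1 - σ) + 1 / n) * (1 + n * D * s) := by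
      have : ((1 - σ) + 1 / n) * (1 + n * D * s) = 1 + 1 / n + n * σ * (1 - σ) := by
        rw [hσ]; field_simp; ring
      rw [this]
      have h3 : (0 : ℝ) ≤ 1 / n := by positivity
      have h4 : 0 ≤ n * σ * (1 - σ) := mul_nonneg (by positivity) (by linarith)
      linarith
    exact le_of_mul_le_mul_right (h1.trans h2) (by positivity)
  -- The difference `q / s - D * q` equals `(q / s) * (1 - σ)`, and `q ≤ s`. This and `hpow` each
  -- contribute one copy of `1 - σ`.
  have hfirst : q / s ≤ D * q + (1 - σ) := by
    rw [div_le_iff₀ h0]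
    have h1 : D * q ≤ σ := by rw [hσ]; gcongr
    have h2 : 0 ≤ (1 - σ) * (s - q) := mul_nonneg (by linarith) (by linarith)
    have : (D * q + (1 - σ)) * s = q + (1 - σ) * (s - q) := by rw [hσ]; ring
    linarith
  have hmain : listExp π (n * D) (firstLoss acc g) ≤ q / s + (1 - s) ^ (n * D) := by
    have := he (n * D)
    rw [mul_comm, ← le_div_iff₀ h0] at this
    rwa [add_div, mul_div_cancel_left₀ _ h0.ne'] at this
  linarith

end ListExpectation

/-! ### Factorisation of the transcript distribution. -/

namespace PrivateCoinProtocol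

variable {X Y Z RA RB : Type*} [Fintype RA] [Fintype RB]

/-- The runs with a given transcript form a rectangle. -/
lemma transcriptUpTo_eq_of_rectangle (P : PrivateCoinProtocol X Y Z RA RB) {x x' : X} {y y' : Y}
    {a a' : RA} {b b' : RB} {i : ℕ} {t : Transcript}
    (h : P.transcriptUpTo x y' a b' i = t) (h' : P.transcriptUpTo x' y a' b i = t) :
    P.transcriptUpTo x y a b i = t := by
  induction i generalizing t with
  | zero => exact h
  | succ i ih =>
    subst h
    simp only [transcriptUpTo] at h' ⊢
    obtain ⟨h1, h2⟩ := List.append_inj' h' rfl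
    have h3 := ih rfl h1
    rw [h3, List.append_right_inj]
    -- Alice's message agrees with the run sharing `x` and `a`, Bob's with the run sharing `y` and
    -- `b`.
    split_ifs with hi
    · rfl
    · simpa [hi, h1] using h2

open Classical in
/-- The probability over Alice's coins that she is consistent with the transcript `t`. -/
noncomputable def aliceWeight (P : PrivateCoinProtocol X Y Z RA RB) (x : X) (t : Transcript) : ℝ :=
  ∑ a, if ∃ y b, P.transcript (x, y, a, b) = t then P.aliceCoins a else 0

open Classical in
/-- The weight of Bob's coin `b` if it is consistent with the transcript `t`, and `0` otherwise. -/
noncomputable def bobCoinWeight (P : PrivateCoinProtocol X Y Z RA RB) (y : Y) (t : Transcript)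
    (b : RB) : ℝ :=
  if ∃ x a, P.transcript (x, y, a, b) = t then P.bobCoins b else 0

/-- The probability over Bob's coins that he is consistent with the transcript `t`. -/
noncomputable def bobWeight (P : PrivateCoinProtocol X Y Z RA RB) (y : Y) (t : Transcript) : ℝ :=
  ∑ b, P.bobCoinWeight y t b

lemma aliceWeight_nonneg (P : PrivateCoinProtocol X Y Z RA RB) (x : X) (t : Transcript) :
    0 ≤ P.aliceWeight x t :=
  Finset.sum_nonneg fun a _ => by
    split_ifs
    · exact P.aliceCoins_mem.1 a
    · exact le_rfl

lemma bobCoinWeight_nonneg (P : PrivateCoinProtocol X Y Z RA RB) (y : Y) (t : Transcript) (b : RB) :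
    0 ≤ P.bobCoinWeight y t b := by
  rw [bobCoinWeight]
  split_ifs
  · exact P.bobCoins_mem.1 b
  · exact le_rfl

lemma bobWeight_nonneg (P : PrivateCoinProtocol X Y Z RA RB) (y : Y) (t : Transcript) :
    0 ≤ P.bobWeight y t :=
  Finset.sum_nonneg fun b _ => P.bobCoinWeight_nonneg y t b

-- By the rectangle property, a coin pair yields `t` exactly when each coin is separately consistent
-- with `t`, so the double sum splits.
open Classical in
lemma sum_coins_transcript (P : PrivateCoinProtocol X Y Z RA RB) (x : X) (y : Y) (t : Transcript)
    (h : RB → ℝ) :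
    ∑ a, ∑ b, (if P.transcript (x, y, a, b) = t then P.aliceCoins a * P.bobCoins b * h b else 0) =
      P.aliceWeight x t * ∑ b, P.bobCoinWeight y t b * h b := by
  rw [aliceWeight, Finset.sum_mul_sum]
  refine Finset.sum_congr rfl fun a _ => Finset.sum_congr rfl fun b _ => ?_
  rw [bobCoinWeight]
  by_cases ht : P.transcript (x, y, a, b) = t
  · rw [if_pos ht, if_pos ⟨y, b, ht⟩, if_pos ⟨x, a, ht⟩]
    ring
  · rw [if_neg ht]
    split_ifs with h1 h2
    · obtain ⟨y', b', h1⟩ := h1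
      obtain ⟨x', a', h2⟩ := h2
      exact absurd (P.transcriptUpTo_eq_of_rectangle h1 h2) ht
    · simp
    · simp
    · simp

/-- The finite type of the transcripts that can occur. -/
abbrev Outcome (P : PrivateCoinProtocol X Y Z RA RB) : Type := Set.range P.transcript

/-- Sums over coins, grouped by transcript. -/
lemma sum_coins (P : PrivateCoinProtocol X Y Z RA RB) [Fintype P.Outcome] (x : X) (y : Y)
    (h : Transcript → RB → ℝ) :
    ∑ a, ∑ b, P.aliceCoins a * P.bobCoins b * h (P.transcript (x, y, a, b)) b =
      ∑ m : P.Outcome, P.aliceWeight x m * ∑ b, P.bobCoinWeight y m b * h m b := by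
  classical
  simp_rw [← sum_coins_transcript]
  rw [Finset.sum_comm (s := (Finset.univ : Finset P.Outcome))]
  refine Finset.sum_congr rfl fun a _ => ?_
  rw [Finset.sum_comm (s := (Finset.univ : Finset P.Outcome))]
  refine Finset.sum_congr rfl fun b _ => ?_
  rw [Finset.sum_eq_single (⟨P.transcript (x, y, a, b), _, rfl⟩ : P.Outcome)]
  · rw [if_pos rfl]
  · intro m _ hm
    rw [if_neg fun h => hm (Subtype.ext h.symm)]
  · simp

lemma sum_aliceWeight_mul_bobWeight (P : PrivateCoinProtocol X Y Z RA RB) [Fintype P.Outcome]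
    (x : X) (y : Y) : ∑ m : P.Outcome, P.aliceWeight x m * P.bobWeight y m = 1 := by
  have h := P.sum_coins x y (fun _ _ => 1)
  simp only [mul_one] at h
  rw [← Finset.sum_mul_sum, P.aliceCoins_mem.2, P.bobCoins_mem.2, one_mul] at h
  exact h.symm

variable [Fintype X] [Fintype Y]

/-- Sums over runs, grouped by inputs and transcript. -/
lemma sum_runs (P : PrivateCoinProtocol X Y Z RA RB) [Fintype P.Outcome] (μX : X → ℝ) (μY : Y → ℝ)
    (h : X → Y → Transcript → RB → ℝ) :
    ∑ ω, P.runDist μX μY ω * h ω.1 ω.2.1 (P.transcript ω) ω.2.2.2 =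
      ∑ x, ∑ y, μX x * μY y * ∑ m : P.Outcome,
        P.aliceWeight x m * ∑ b, P.bobCoinWeight y m b * h x y m b := by
  rw [Fintype.sum_prod_type]
  refine Finset.sum_congr rfl fun x _ => ?_
  rw [Fintype.sum_prod_type]
  refine Finset.sum_congr rfl fun y _ => ?_
  rw [← sum_coins, Fintype.sum_prod_type, Finset.mul_sum]
  refine Finset.sum_congr rfl fun a _ => ?_
  rw [Finset.mul_sum]
  refine Finset.sum_congr rfl fun b _ => ?_
  rw [runDist]
  ring

open Classical in
lemma prob_runDist (P : PrivateCoinProtocol X Y Z RA RB) [Fintype P.Outcome] (μX : X → ℝ)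
    (μY : Y → ℝ) (E : X → Y → Transcript → Prop) :
    prob (P.runDist μX μY) (fun ω => E ω.1 ω.2.1 (P.transcript ω)) =
      ∑ x, ∑ y, μX x * μY y * ∑ m : P.Outcome,
        if E x y m then P.aliceWeight x m * P.bobWeight y m else 0 := by
  have h := P.sum_runs μX μY (fun x y t _ => if E x y t then 1 else 0)
  simp only [mul_ite, mul_one, mul_zero] at h
  rw [prob_eq_sum_ite, h]
  refine Finset.sum_congr rfl fun x _ => Finset.sum_congr rfl fun y _ => ?_
  congr 1
  refine Finset.sum_congr rfl fun m _ => ?_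
  split_ifs
  · rfl
  · simp

lemma runDist_mem (P : PrivateCoinProtocol X Y Z RA RB) {μX : X → ℝ} {μY : Y → ℝ}
    (hμX : μX ∈ stdSimplex ℝ X) (hμY : μY ∈ stdSimplex ℝ Y) :
    P.runDist μX μY ∈ stdSimplex ℝ (X × Y × RA × RB) := by
  refine ⟨fun ω => mul_nonneg (mul_nonneg (hμX.1 _) (hμY.1 _))
    (mul_nonneg (P.aliceCoins_mem.1 _) (P.bobCoins_mem.1 _)), ?_⟩
  simp only [runDist, Fintype.sum_prod_type, ← Finset.mul_sum, P.bobCoins_mem.2, mul_one,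
    P.aliceCoins_mem.2, hμY.2, hμX.2]

end PrivateCoinProtocol

/-! ### Independent acceptance bits and acceptance probabilities. -/

section Bernoulli

variable {X : Type*} [Fintype X]

/-- The product of Bernoulli distributions with success probabilities `α`. -/
noncomputable def bernoulliWeight (α : X → ℝ) (u : X → Bool) : ℝ :=
  ∏ x, if u x then α x else 1 - α x

lemma bernoulliWeight_nonneg {α : X → ℝ} (h0 : ∀ x, 0 ≤ α x) (h1 : ∀ x, α x ≤ 1) (u : X → Bool) :
    0 ≤ bernoulliWeight α u :=
  Finset.prod_nonneg fun x _ => by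
    split_ifs
    · exact h0 x
    · linarith [h1 x]

lemma sum_prod_bool [DecidableEq X] (h : X → Bool → ℝ) :
    ∑ u : X → Bool, ∏ x, h x (u x) = ∏ x, (h x true + h x false) := by
  have := Finset.prod_univ_sum (fun _ : X => (Finset.univ : Finset Bool)) h
  rw [Fintype.piFinset_univ] at this
  simpa only [Fintype.sum_bool] using this.symm

lemma sum_bernoulliWeight [DecidableEq X] (α : X → ℝ) : ∑ u, bernoulliWeight α u = 1 := by
  have := sum_prod_bool (fun x c => if c then α x else 1 - α x)
  simpa [bernoulliWeight] using this

lemma sum_bernoulliWeight_apply [DecidableEq X] (α : X → ℝ) (x : X) :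
    (∑ u : X → Bool, if u x then bernoulliWeight α u else 0) = α x := by
  -- Setting the factor of `x` to zero at `false` absorbs the condition `u x` into the product.
  have := sum_prod_bool
    (fun x' c => if x' = x then (if c then α x' else 0) else if c then α x' else 1 - α x')
  rw [Finset.prod_eq_single x (fun x' _ hx => by simp [hx]) (by simp)] at this
  simp only [if_true, Bool.false_eq_true, if_false, add_zero] at this
  rw [← this]
  refine Finset.sum_congr rfl fun u _ => ?_
  cases hu : u x
  · rw [if_neg (by simp)]
    exact (Finset.prod_eq_zero (Finset.mem_univ x) (by simp [hu])).symm
  · rw [if_pos rfl, bernoulliWeight]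
    refine Finset.prod_congr rfl fun x' _ => ?_
    by_cases hx : x' = x
    · subst hx; simp [hu]
    · simp [hx]

end Bernoulli

section Accept

variable {X M : Type*} [Fintype X]

/-- The average of the weights `A x m` over the input `x`. -/
noncomputable def avgWeight (μ : X → ℝ) (A : X → M → ℝ) (m : M) : ℝ := ∑ x, μ x * A x m

open Classical in
/-- The probability of accepting the sample `m` on input `x`. -/
noncomputable def acceptProb (μ : X → ℝ) (A : X → M → ℝ) (a : ℕ) (m : M) (x : X) : ℝ :=
  if A x m ≤ 2 ^ a * avgWeight μ A m then A x m / (2 ^ a * avgWeight μ A m) else 0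

variable {μ : X → ℝ} {A : X → M → ℝ}

lemma avgWeight_nonneg (hμ : ∀ x, 0 ≤ μ x) (hA : ∀ x m, 0 ≤ A x m) (m : M) :
    0 ≤ avgWeight μ A m :=
  Finset.sum_nonneg fun x _ => mul_nonneg (hμ x) (hA x m)

lemma acceptProb_nonneg (hμ : ∀ x, 0 ≤ μ x) (hA : ∀ x m, 0 ≤ A x m) (a : ℕ) (m : M) (x : X) :
    0 ≤ acceptProb μ A a m x := by
  rw [acceptProb]
  split_ifs
  · exact div_nonneg (hA x m) (mul_nonneg (by positivity) (avgWeight_nonneg hμ hA m))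
  · exact le_rfl

lemma acceptProb_le_one (hμ : ∀ x, 0 ≤ μ x) (hA : ∀ x m, 0 ≤ A x m) (a : ℕ) (m : M) (x : X) :
    acceptProb μ A a m x ≤ 1 := by
  rw [acceptProb]
  split_ifs with h
  · exact div_le_one_of_le₀ h (mul_nonneg (by positivity) (avgWeight_nonneg hμ hA m))
  · exact zero_le_one

-- If the average vanishes, the truncation condition forces `A x m = 0`, so the division by zero is
-- harmless.
open Classical in
lemma avgWeight_mul_acceptProb (hA : ∀ x m, 0 ≤ A x m) (a : ℕ)
    (m : M) (x : X) : 2 ^ a * (avgWeight μ A m * acceptProb μ A a m x) =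
      if A x m ≤ 2 ^ a * avgWeight μ A m then A x m else 0 := by
  rw [acceptProb]
  split_ifs with h
  · by_cases h0 : avgWeight μ A m = 0
    · rw [h0, mul_zero] at h
      rw [h0, le_antisymm h (hA x m)]
      simp
    · field_simp
  · simp

end Accept

lemma sum_mul_avgWeight {X Y M : Type*} [Fintype Y] [Fintype M] {μY : Y → ℝ}
    (hμY : μY ∈ stdSimplex ℝ Y) {A : X → M → ℝ} {B : Y → M → ℝ}
    (hAB : ∀ x y, ∑ m, A x m * B y m = 1) (x : X) : ∑ m, A x m * avgWeight μY B m = 1 := by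
  simp_rw [avgWeight, Finset.mul_sum]
  rw [Finset.sum_comm, ← hμY.2]
  refine Finset.sum_congr rfl fun y _ => ?_
  calc ∑ m, A x m * (μY y * B y m) = μY y * ∑ m, A x m * B y m := by
        rw [Finset.mul_sum]
        exact Finset.sum_congr rfl fun m _ => by ring
    _ = μY y := by rw [hAB, mul_one]

/-! ### Public samples and a good fixed list. -/

section Sampling

variable {X Y M : Type*} [Fintype X] [Fintype Y] [Fintype M]

/-- The distribution of a public sample: an outcome, and for every input of either player whether
the player accepts it on that input. -/
noncomputable def sampleWeight (μX : X → ℝ) (μY : Y → ℝ) (A : X → M → ℝ) (B : Y → M → ℝ) (a b : ℕ)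
    (w : M × (X → Bool) × (Y → Bool)) : ℝ :=
  avgWeight μX A w.1 * avgWeight μY B w.1 *
    (bernoulliWeight (acceptProb μX A a w.1) w.2.1 * bernoulliWeight (acceptProb μY B b w.1) w.2.2)

variable [DecidableEq X] [DecidableEq Y]

/-- For a given outcome the two acceptance bits are independent with the prescribed marginals. -/
lemma sum_sampleWeight_accept_both (μX : X → ℝ) (μY : Y → ℝ) (A : X → M → ℝ) (B : Y → M → ℝ)
    (a b : ℕ) (x : X) (y : Y) (g : M → ℝ) :
    (∑ w : M × (X → Bool) × (Y → Bool), if w.2.1 x && w.2.2 y then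
        sampleWeight μX μY A B a b w * g w.1 else 0) =
      ∑ m, (avgWeight μX A m * acceptProb μX A a m x) *
        (avgWeight μY B m * acceptProb μY B b m y) * g m := by
  rw [Fintype.sum_prod_type]
  refine Finset.sum_congr rfl fun m _ => ?_
  rw [← sum_bernoulliWeight_apply (acceptProb μX A a m) x,
    ← sum_bernoulliWeight_apply (acceptProb μY B b m) y, Finset.mul_sum, Finset.mul_sum,
    Finset.sum_mul_sum, Finset.sum_mul, Fintype.sum_prod_type]
  refine Finset.sum_congr rfl fun u _ => ?_
  rw [Finset.sum_mul]
  refine Finset.sum_congr rfl fun v _ => ?_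
  cases hu : u x <;> cases hv : v y <;> simp only [hu, hv, sampleWeight, Bool.and_true,
    Bool.and_false, Bool.false_eq_true, if_true, if_false, mul_zero, zero_mul]
  ring

lemma sum_sampleWeight_accept (μX : X → ℝ) (μY : Y → ℝ) (A : X → M → ℝ) (B : Y → M → ℝ)
    (a b : ℕ) (x : X) :
    (∑ w : M × (X → Bool) × (Y → Bool), if w.2.1 x then sampleWeight μX μY A B a b w else 0) =
      ∑ m, (avgWeight μX A m * acceptProb μX A a m x) * avgWeight μY B m := by
  rw [Fintype.sum_prod_type]
  refine Finset.sum_congr rfl fun m _ => ?_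
  rw [← sum_bernoulliWeight_apply (acceptProb μX A a m) x,
    ← mul_one (avgWeight μY B m), ← sum_bernoulliWeight (acceptProb μY B b m), Finset.mul_sum,
    Finset.mul_sum, Finset.sum_mul_sum, Fintype.sum_prod_type]
  refine Finset.sum_congr rfl fun u _ => Finset.sum_congr rfl fun v _ => ?_
  cases hu : u x <;> simp [hu, sampleWeight]
  ring

lemma sum_sampleWeight (μX : X → ℝ) (μY : Y → ℝ) (A : X → M → ℝ) (B : Y → M → ℝ) (a b : ℕ) :
    ∑ w, sampleWeight μX μY A B a b w = ∑ m, avgWeight μX A m * avgWeight μY B m := by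
  rw [Fintype.sum_prod_type]
  refine Finset.sum_congr rfl fun m _ => ?_
  simp only [sampleWeight]
  rw [← Finset.mul_sum, Fintype.sum_prod_type, ← Finset.sum_mul_sum, sum_bernoulliWeight,
    sum_bernoulliWeight, one_mul, mul_one]

lemma sampleWeight_mem {μX : X → ℝ} {μY : Y → ℝ} (hμX : μX ∈ stdSimplex ℝ X)
    (hμY : μY ∈ stdSimplex ℝ Y) {A : X → M → ℝ} {B : Y → M → ℝ} (hA : ∀ x m, 0 ≤ A x m)
    (hB : ∀ y m, 0 ≤ B y m) (hAB : ∀ x y, ∑ m, A x m * B y m = 1) (a b : ℕ) :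
    sampleWeight μX μY A B a b ∈ stdSimplex ℝ (M × (X → Bool) × (Y → Bool)) := by
  refine ⟨fun w => ?_, ?_⟩
  · exact mul_nonneg (mul_nonneg (avgWeight_nonneg hμX.1 hA _) (avgWeight_nonneg hμY.1 hB _))
      (mul_nonneg
        (bernoulliWeight_nonneg (acceptProb_nonneg hμX.1 hA a _) (acceptProb_le_one hμX.1 hA a _) _)
        (bernoulliWeight_nonneg (acceptProb_nonneg hμY.1 hB b _) (acceptProb_le_one hμY.1 hB b _) _))
  · rw [sum_sampleWeight]
    simp_rw [avgWeight.eq_1 μX, Finset.sum_mul]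
    rw [Finset.sum_comm, ← hμX.2]
    refine Finset.sum_congr rfl fun x _ => ?_
    calc ∑ m, μX x * A x m * avgWeight μY B m = μX x * ∑ m, A x m * avgWeight μY B m := by
          rw [Finset.mul_sum]
          exact Finset.sum_congr rfl fun m _ => by ring
      _ = μX x := by rw [sum_mul_avgWeight hμY hAB, mul_one]

open Classical in
/-- There is a list of samples for which, on average over the inputs, the first sample accepted by
both players has small loss and Alice accepts few samples. -/
theorem exists_sample_list {μX : X → ℝ} {μY : Y → ℝ} (hμX : μX ∈ stdSimplex ℝ X)
    (hμY : μY ∈ stdSimplex ℝ Y) {A : X → M → ℝ} {B : Y → M → ℝ} (hA : ∀ x m, 0 ≤ A x m)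
    (hB : ∀ y m, 0 ≤ B y m) (hAB : ∀ x y, ∑ m, A x m * B y m = 1) {G : X → Y → M → ℝ}
    (hG0 : ∀ x y m, 0 ≤ G x y m) (hG1 : ∀ x y m, G x y m ≤ 1) (a b : ℕ) {n : ℕ} (hn : 0 < n)
    (K : ℕ) {ε τA τB : ℝ}
    (hε : ∑ x, ∑ y, μX x * μY y * ∑ m, A x m * B y m * G x y m ≤ ε)
    (hτA : ∑ x, ∑ y, μX x * μY y * ∑ m, (if 2 ^ a * avgWeight μX A m < A x m then
      A x m * B y m else 0) ≤ τA)
    (hτB : ∑ x, ∑ y, μX x * μY y * ∑ m, (if 2 ^ b * avgWeight μY B m < B y m then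
      A x m * B y m else 0) ≤ τB) :
    ∃ l : List (M × (X → Bool) × (Y → Bool)), l.length = n * 2 ^ (a + b) ∧
      ∑ x, ∑ y, μX x * μY y * (firstLoss (fun w => w.2.1 x && w.2.2 y) (fun w => G x y w.1) l +
        (1 / K) * (l.countP (fun w => w.2.1 x) : ℝ)) ≤
          ε + 2 * (τA + τB) + 1 / n + n * 2 ^ b / K := by
  have hπ := sampleWeight_mem hμX hμY hA hB hAB a b
  obtain ⟨l, hl, hF⟩ := exists_le_listExp hπ (n * 2 ^ (a + b)) (fun l =>
    ∑ x, ∑ y, μX x * μY y * (firstLoss (fun w => w.2.1 x && w.2.2 y) (fun w => G x y w.1) l +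
        (1 / K) * (l.countP (fun w => w.2.1 x) : ℝ)))
  refine ⟨l, hl, hF.trans ?_⟩
  simp_rw [listExp_sum, listExp_const_mul, listExp_add, listExp_const_mul]
  -- Alice accepts each sample with probability at most `2 ^ (-a)`.
  have hcount : ∀ x, listExp (sampleWeight μX μY A B a b) (n * 2 ^ (a + b))
      (fun l => (l.countP (fun w => w.2.1 x) : ℝ)) ≤ n * 2 ^ b := by
    intro x
    rw [listExp_countP hπ.2, sum_sampleWeight_accept]
    have h1 : 2 ^ a * ∑ m, (avgWeight μX A m * acceptProb μX A a m x) * avgWeight μY B m ≤ 1 := by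
      rw [← sum_mul_avgWeight hμY hAB x, Finset.mul_sum]
      refine Finset.sum_le_sum fun m _ => ?_
      rw [← mul_assoc, avgWeight_mul_acceptProb hA]
      have := avgWeight_nonneg hμY.1 hB m
      split_ifs
      · exact le_rfl
      · rw [zero_mul]; exact mul_nonneg (hA x m) this
    calc _ = n * 2 ^ b * (2 ^ a * ∑ m, (avgWeight μX A m * acceptProb μX A a m x) *
          avgWeight μY B m) := by push_cast; ring
      _ ≤ n * 2 ^ b * 1 := by gcongr
      _ = n * 2 ^ b := mul_one _
  have hfirst : ∀ x y, listExp (sampleWeight μX μY A B a b) (n * 2 ^ (a + b))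
      (firstLoss (fun w => w.2.1 x && w.2.2 y) (fun w => G x y w.1)) ≤
      ∑ m, A x m * B y m * G x y m +
        2 * (∑ m, (if 2 ^ a * avgWeight μX A m < A x m then A x m * B y m else 0) +
          ∑ m, (if 2 ^ b * avgWeight μY B m < B y m then A x m * B y m else 0)) + 1 / n := by
    intro x y
    have hacc : ∀ g : M → ℝ, ((2 ^ (a + b) : ℕ) : ℝ) *
        (∑ w : M × (X → Bool) × (Y → Bool), if w.2.1 x && w.2.2 y then
          sampleWeight μX μY A B a b w * g w.1 else 0) =
        ∑ m, (if A x m ≤ 2 ^ a * avgWeight μX A m then A x m else 0) *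
          (if B y m ≤ 2 ^ b * avgWeight μY B m then B y m else 0) * g m := by
      intro g
      rw [sum_sampleWeight_accept_both, Finset.mul_sum]
      refine Finset.sum_congr rfl fun m _ => ?_
      rw [← avgWeight_mul_acceptProb hA, ← avgWeight_mul_acceptProb hB]
      push_cast
      ring
    have hacc1 := hacc (fun _ => 1)
    simp only [mul_one] at hacc1
    have h0 : ∀ m, 0 ≤ A x m * B y m := fun m => mul_nonneg (hA x m) (hB y m)
    have hle : ∀ m, (if A x m ≤ 2 ^ a * avgWeight μX A m then A x m else 0) *
        (if B y m ≤ 2 ^ b * avgWeight μY B m then B y m else 0) ≤ A x m * B y m := by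
      intro m
      split_ifs <;> simp [h0 m]
    have key := listExp_firstLoss_le hπ (fun w => w.2.1 x && w.2.2 y) (g := fun w => G x y w.1)
      (fun w => hG0 x y w.1) (fun w => hG1 x y w.1) (D := 2 ^ (a + b)) hn (by
        rw [hacc1, ← hAB x y]
        exact Finset.sum_le_sum fun m _ => hle m)
    rw [hacc1, hacc (G x y)] at key
    refine key.trans ?_
    have h1 : ∑ m, (if A x m ≤ 2 ^ a * avgWeight μX A m then A x m else 0) *
          (if B y m ≤ 2 ^ b * avgWeight μY B m then B y m else 0) * G x y m ≤
        ∑ m, A x m * B y m * G x y m :=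
      Finset.sum_le_sum fun m _ => mul_le_mul_of_nonneg_right (hle m) (hG0 x y m)
    -- The mass lost by truncation lies in one of the two tails.
    have h2 : 1 - ∑ m, (if A x m ≤ 2 ^ a * avgWeight μX A m then A x m else 0) *
          (if B y m ≤ 2 ^ b * avgWeight μY B m then B y m else 0) ≤
        ∑ m, (if 2 ^ a * avgWeight μX A m < A x m then A x m * B y m else 0) +
          ∑ m, (if 2 ^ b * avgWeight μY B m < B y m then A x m * B y m else 0) := by
      rw [← hAB x y, ← Finset.sum_sub_distrib, ← Finset.sum_add_distrib]
      refine Finset.sum_le_sum fun m _ => ?_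
      have := h0 m
      simp only [← not_lt]
      split_ifs <;> simp_all
    linarith
  have hsum : ∑ x, ∑ y, μX x * μY y = 1 := by
    rw [← Finset.sum_mul_sum, hμX.2, hμY.2, one_mul]
  calc _ ≤ ∑ x, ∑ y, μX x * μY y * (∑ m, A x m * B y m * G x y m +
        2 * (∑ m, (if 2 ^ a * avgWeight μX A m < A x m then A x m * B y m else 0) +
          ∑ m, (if 2 ^ b * avgWeight μY B m < B y m then A x m * B y m else 0)) + 1 / n +
        (1 / K) * (n * 2 ^ b)) := by
        refine Finset.sum_le_sum fun x _ => Finset.sum_le_sum fun y _ => ?_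
        have := mul_nonneg (hμX.1 x) (hμY.1 y)
        have h1 := hfirst x y
        have h2 := hcount x
        gcongr
    _ = ∑ x, ∑ y, μX x * μY y * ∑ m, A x m * B y m * G x y m +
        2 * (∑ x, ∑ y, μX x * μY y * ∑ m, (if 2 ^ a * avgWeight μX A m < A x m then
            A x m * B y m else 0) +
          ∑ x, ∑ y, μX x * μY y * ∑ m, (if 2 ^ b * avgWeight μY B m < B y m then
            A x m * B y m else 0)) +
        (∑ x, ∑ y, μX x * μY y) * (1 / n + n * 2 ^ b / K) := by
        have e : ∀ x y (s t u : ℝ), μX x * μY y * (s + 2 * (t + u) + 1 / n + (1 / K) * (n * 2 ^ b)) =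
            μX x * μY y * s + (2 * (μX x * μY y * t) + (2 * (μX x * μY y * u) +
              μX x * μY y * (1 / n + n * 2 ^ b / K))) := fun x y s t u => by ring
        simp_rw [e, Finset.sum_add_distrib, ← Finset.mul_sum, ← Finset.sum_mul]
        rw [hsum, hμX.2, hμY.2]
        ring
    _ ≤ _ := by
        rw [hsum]
        linarith

end Sampling

/-! ### Encoding the accepted samples and building the one-way protocol. -/

section Encoding

/-- Lists of length at most `K` with entries in `l` can be encoded by `K * t` bits. -/
lemma exists_list_encoding {W : Type*} (l : List W) (K : ℕ) {t : ℕ} (ht : l.length < 2 ^ t) :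
    ∃ e : List W → (Fin (K * t) → Bool), Set.InjOn e {L | L.length ≤ K ∧ ∀ w ∈ L, w ∈ l} := by
  classical
  let S := {w // w ∈ l.toFinset}
  -- `none` pads lists shorter than `K`; the strict inequality `ht` leaves room for this extra
  -- symbol.
  have hcard : Fintype.card (Fin K → Option S) ≤ Fintype.card (Fin (K * t) → Bool) := by
    have h1 : Fintype.card S ≤ l.length := by
      rw [Fintype.card_coe]; exact l.toFinset_card_le
    simp only [Fintype.card_pi_const, Fintype.card_option, Fintype.card_bool]
    rw [mul_comm, pow_mul]
    exact Nat.pow_le_pow_left (by omega) K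
  obtain ⟨emb⟩ := Function.Embedding.nonempty_of_card_le hcard
  let f : W → Option S := fun w => if h : w ∈ l.toFinset then some ⟨w, h⟩ else none
  refine ⟨fun L => emb (fun j => L[(j : ℕ)]?.bind f), ?_⟩
  rintro L ⟨hL, hLl⟩ L' ⟨hL', hLl'⟩ h
  have h2 := emb.injective h
  refine List.ext_getElem? fun i => ?_
  by_cases hi : i < K
  · have h3 := congrFun h2 ⟨i, hi⟩
    have hf : ∀ w ∈ l, ∃ s : S, f w = some s ∧ s.1 = w := fun w hw =>
      ⟨⟨w, by simpa using hw⟩, by simp [f, hw], rfl⟩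
    simp only at h3
    cases h4 : L[i]? with
    | none =>
      cases h5 : L'[i]? with
      | none => rfl
      | some w' =>
        obtain ⟨s, hs, -⟩ := hf w' (hLl' w' (List.mem_of_getElem? h5))
        simp [h4, h5, hs] at h3
    | some w =>
      obtain ⟨s, hs, hs'⟩ := hf w (hLl w (List.mem_of_getElem? h4))
      cases h5 : L'[i]? with
      | none => simp [h4, h5, hs] at h3
      | some w' =>
        obtain ⟨s', hs2, hs3⟩ := hf w' (hLl' w' (List.mem_of_getElem? h5))
        simp only [h4, h5, Option.bind_some, hs, hs2, Option.some.injEq] at h3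
        rw [← hs', ← hs3, h3]
  · rw [List.getElem?_eq_none (by omega), List.getElem?_eq_none (by omega)]

end Encoding

open Classical in
/-- A two-player randomised outcome whose distribution factorises can be replaced by a
deterministic one-way protocol, at a cost governed by the tails of the players' likelihood ratios. -/
theorem exists_oneWayDetProtocol {X Y Z M : Type*} [Fintype X] [Fintype Y] [Fintype M] [Nonempty M]
    (f : Set (X × Y × Z)) {μX : X → ℝ} {μY : Y → ℝ} (hμX : μX ∈ stdSimplex ℝ X)
    (hμY : μY ∈ stdSimplex ℝ Y) {A : X → M → ℝ} {B : Y → M → ℝ} (hA : ∀ x m, 0 ≤ A x m)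
    (hB : ∀ y m, 0 ≤ B y m) (hAB : ∀ x y, ∑ m, A x m * B y m = 1) (z : Y → M → Z)
    (a b : ℕ) {n : ℕ} (hn : 0 < n) {ε τA τB : ℝ}
    (hε : ∑ x, ∑ y, μX x * μY y * ∑ m, A x m * B y m *
      (if (x, y, z y m) ∉ f then 1 else 0) ≤ ε)
    (hτA : ∑ x, ∑ y, μX x * μY y * ∑ m, (if 2 ^ a * avgWeight μX A m < A x m then
      A x m * B y m else 0) ≤ τA)
    (hτB : ∑ x, ∑ y, μX x * μY y * ∑ m, (if 2 ^ b * avgWeight μY B m < B y m then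
      A x m * B y m else 0) ≤ τB) :
    ∃ Q : OneWayDetProtocol X Y Z, Q.cost = n * n * 2 ^ b * (n + a + b) ∧
      Q.error f μX μY ≤ ε + 2 * (τA + τB) + 2 / n := by
  obtain ⟨l, hl, hF⟩ := exists_sample_list hμX hμY hA hB hAB
    (G := fun x y m => if (x, y, z y m) ∉ f then 1 else 0)
    (fun x y m => by split_ifs <;> norm_num) (fun x y m => by split_ifs <;> norm_num)
    a b hn (n * n * 2 ^ b) hε hτA hτB
  have hK : 0 < n * n * 2 ^ b := by positivity
  set K := n * n * 2 ^ b with hKdef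
  -- Since `n < 2 ^ n`, an index into the list, or the padding symbol, fits into `n + a + b` bits.
  have hlt : l.length < 2 ^ (n + a + b) := by
    rw [hl, add_assoc, pow_add 2 n]
    exact Nat.mul_lt_mul_of_pos_right Nat.lt_two_pow_self (by positivity)
  obtain ⟨e, he⟩ := exists_list_encoding l K hlt
  let accepted : X → List (M × (X → Bool) × (Y → Bool)) :=
    fun x => (l.filter (fun w => w.2.1 x)).take K
  have hmem : ∀ x, accepted x ∈ {L | L.length ≤ K ∧ ∀ w ∈ L, w ∈ l} := fun x =>
    ⟨List.length_take_le _ _, fun w hw => (List.mem_filter.mp (List.mem_of_mem_take hw)).1⟩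
  let decode := Function.invFunOn e {L | L.length ≤ K ∧ ∀ w ∈ L, w ∈ l}
  have hdecode : ∀ x, decode (e (accepted x)) = accepted x := fun x =>
    he.leftInvOn_invFunOn (hmem x)
  -- The arbitrary default outcome is harmless: `firstLoss` already charges `1` when no sample is
  -- accepted by both.
  let Q : OneWayDetProtocol X Y Z :=
    { cost := K * (n + a + b)
      msg := fun x => e (accepted x)
      output := fun y s => z y
        (((decode s).find? (fun w => w.2.2 y)).elim (Classical.arbitrary M) (fun w => w.1)) }
  refine ⟨Q, rfl, ?_⟩
  have hone : ∀ (p : Prop) [Decidable p], (if p then (1 : ℝ) else 0) ≤ 1 := fun p _ => by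
    split_ifs <;> norm_num
  -- If Alice accepts at most `K` samples, nothing is cut off and Bob finds the first jointly
  -- accepted one. Otherwise the count term alone is at least `1`.
  have hpoint : ∀ x y, (if (x, y, Q.output y (Q.msg x)) ∉ f then (1 : ℝ) else 0) ≤
      firstLoss (fun w => w.2.1 x && w.2.2 y)
        (fun w => if (x, y, z y w.1) ∉ f then (1 : ℝ) else 0) l +
        (1 / (K : ℕ)) * (l.countP (fun w => w.2.1 x) : ℝ) := by
    intro x y
    have hK' : (0 : ℝ) < (K : ℕ) := by exact_mod_cast hK
    have hfl : 0 ≤ firstLoss (fun w => w.2.1 x && w.2.2 y)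
        (fun w => if (x, y, z y w.1) ∉ f then (1 : ℝ) else 0) l := by
      rw [firstLoss]
      cases l.find? (fun w => w.2.1 x && w.2.2 y) with
      | none => simp
      | some w => simp only [Option.elim_some]; split_ifs <;> norm_num
    have hcn : (0 : ℝ) ≤ (1 / (K : ℕ)) * (l.countP (fun w => w.2.1 x) : ℝ) := by positivity
    by_cases hc : l.countP (fun w => w.2.1 x) ≤ K
    · have hacc : accepted x = l.filter (fun w => w.2.1 x) :=
        List.take_of_length_le (by rwa [← List.countP_eq_length_filter])
      have hout : Q.output y (Q.msg x) = z y ((l.find? (fun w => w.2.1 x && w.2.2 y)).elim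
          (Classical.arbitrary M) (fun w => w.1)) := by
        change z y (((decode (e (accepted x))).find? (fun w => w.2.2 y)).elim
          (Classical.arbitrary M) (fun w => w.1)) = _
        rw [hdecode, hacc, List.find?_filter]
        simp only [Bool.decide_and, Bool.decide_eq_true]
      rw [hout]
      refine le_add_of_le_of_nonneg ?_ hcn
      rw [firstLoss]
      cases l.find? (fun w => w.2.1 x && w.2.2 y) with
      | none => exact hone _
      | some w => exact le_rfl
    · have h1 : (1 : ℝ) ≤ (1 / (K : ℕ)) * (l.countP (fun w => w.2.1 x) : ℝ) := by
        rw [one_div, inv_mul_eq_div, one_le_div hK']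
        exact_mod_cast (not_le.mp hc).le
      exact le_add_of_nonneg_of_le hfl ((hone _).trans h1)
  have herr : Q.error f μX μY = ∑ x, ∑ y, μX x * μY y *
      (if (x, y, Q.output y (Q.msg x)) ∉ f then (1 : ℝ) else 0) := by
    rw [OneWayDetProtocol.error, prob_eq_sum_ite, Fintype.sum_prod_type]
    simp
  have hn' : (0 : ℝ) < n := by exact_mod_cast hn
  calc Q.error f μX μY ≤ _ := by
        rw [herr]
        exact Finset.sum_le_sum fun x _ => Finset.sum_le_sum fun y _ =>
          mul_le_mul_of_nonneg_left (hpoint x y) (mul_nonneg (hμX.1 x) (hμY.1 y))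
    _ ≤ _ := hF
    _ = ε + 2 * (τA + τB) + 2 / n := by
        rw [hKdef]
        push_cast
        field_simp
        ring

/-! ### Tails of the likelihood ratios, and Bob's deterministic answer. -/

namespace PrivateCoinProtocol

variable {X Y Z RA RB : Type*} [Fintype X] [Fintype Y] [Fintype RA] [Fintype RB]

section Tails

variable (P : PrivateCoinProtocol X Y Z RA RB) [Fintype P.Outcome] {μX : X → ℝ} {μY : Y → ℝ}

lemma prob_alice_input (hμY : μY ∈ stdSimplex ℝ Y) (x : X) :
    prob (P.runDist μX μY) (fun ω => ω.1 = x) = μX x := by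
  classical
  rw [P.prob_runDist μX μY (fun x' _ _ => x' = x), Finset.sum_eq_single x]
  · simp [sum_aliceWeight_mul_bobWeight, ← Finset.mul_sum, hμY.2]
  · intro x' _ hx
    simp [hx]
  · simp

lemma prob_bob_input (hμX : μX ∈ stdSimplex ℝ X) (y : Y) :
    prob (P.runDist μX μY) (fun ω => ω.2.1 = y) = μY y := by
  classical
  rw [P.prob_runDist μX μY (fun _ y' _ => y' = y), Finset.sum_comm, Finset.sum_eq_single y]
  · simp [sum_aliceWeight_mul_bobWeight, ← Finset.sum_mul, hμX.2]
  · intro y' _ hy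
    simp [hy]
  · simp

/-- The average over the inputs of Alice's weight of an outcome. -/
noncomputable abbrev aliceAvg (μX : X → ℝ) : P.Outcome → ℝ :=
  avgWeight μX (fun x (m : P.Outcome) => P.aliceWeight x m)

/-- The average over the inputs of Bob's weight of an outcome. -/
noncomputable abbrev bobAvg (μY : Y → ℝ) : P.Outcome → ℝ :=
  avgWeight μY (fun y (m : P.Outcome) => P.bobWeight y m)

lemma prob_transcript (m : P.Outcome) :
    prob (P.runDist μX μY) (fun ω => P.transcript ω = m) = P.aliceAvg μX m * P.bobAvg μY m := by
  classical
  rw [P.prob_runDist μX μY (fun _ _ t => t = m)]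
  simp_rw [Subtype.coe_inj, Finset.sum_ite_eq', aliceAvg, bobAvg, avgWeight, Finset.sum_mul_sum]
  simp only [Finset.mem_univ, if_true]
  exact Finset.sum_congr rfl fun x _ => Finset.sum_congr rfl fun y _ => by ring

lemma prob_alice_input_transcript (x : X) (m : P.Outcome) :
    prob (P.runDist μX μY) (fun ω => (ω.1, P.transcript ω) = (x, (m : Transcript))) =
      μX x * P.aliceWeight x m * P.bobAvg μY m := by
  classical
  simp_rw [Prod.mk.injEq]
  rw [P.prob_runDist μX μY (fun x' _ t => x' = x ∧ t = m), Finset.sum_eq_single x]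
  · simp_rw [Subtype.coe_inj, true_and, Finset.sum_ite_eq', bobAvg, avgWeight, Finset.mul_sum]
    simp only [Finset.mem_univ, if_true]
    exact Finset.sum_congr rfl fun y _ => by ring
  · intro x' _ hx
    simp [hx]
  · simp

lemma prob_bob_input_transcript (y : Y) (m : P.Outcome) :
    prob (P.runDist μX μY) (fun ω => (ω.2.1, P.transcript ω) = (y, (m : Transcript))) =
      μY y * P.bobWeight y m * P.aliceAvg μX m := by
  classical
  simp_rw [Prod.mk.injEq]
  rw [P.prob_runDist μX μY (fun _ y' t => y' = y ∧ t = m), Finset.sum_comm,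
    Finset.sum_eq_single y]
  · simp_rw [Subtype.coe_inj, true_and, Finset.sum_ite_eq', aliceAvg, avgWeight, Finset.mul_sum]
    simp only [Finset.mem_univ, if_true]
    exact Finset.sum_congr rfl fun y _ => by ring
  · intro y' _ hy
    simp [hy]
  · simp

open Classical in
/-- Alice's likelihood ratio exceeds `2 ^ a` with probability at most `(I(X : M) + 2) / a`. -/
lemma mul_alice_tail_le (hμX : μX ∈ stdSimplex ℝ X) (hμY : μY ∈ stdSimplex ℝ Y) (a : ℕ) :
    a * (∑ x, ∑ y, μX x * μY y * ∑ m : P.Outcome,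
      (if 2 ^ a * P.aliceAvg μX m < P.aliceWeight x m then
        P.aliceWeight x m * P.bobWeight y m else 0)) ≤ P.privacyLossAlice μX μY + 2 := by
  refine le_trans ?_ (mul_prob_lt_joint_le (P.runDist_mem hμX hμY) (fun ω => ω.1) P.transcript a)
  refine mul_le_mul_of_nonneg_left ?_ (Nat.cast_nonneg a)
  -- Bob's average cancels from the joint density of input and transcript, which leaves `aliceWeight
  -- / aliceAvg`.
  rw [P.prob_runDist μX μY (fun x _ t => 2 ^ a * (prob (P.runDist μX μY) (fun ω' => ω'.1 = x) *
    prob (P.runDist μX μY) (fun ω' => P.transcript ω' = t)) <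
      prob (P.runDist μX μY) (fun ω' => (ω'.1, P.transcript ω') = (x, t)))]
  simp_rw [prob_alice_input_transcript, prob_transcript, P.prob_alice_input hμY]
  refine Finset.sum_le_sum fun x _ => Finset.sum_le_sum fun y _ => ?_
  rw [Finset.mul_sum, Finset.mul_sum]
  refine Finset.sum_le_sum fun m _ => ?_
  have hx := hμX.1 x
  have hy := hμY.1 y
  have hA := P.aliceWeight_nonneg x m
  have hB := P.bobWeight_nonneg y m
  split_ifs with h1 h2 h2
  · exact le_rfl
  · rw [mul_zero]
    -- Cancelling `μX x` and Bob's average requires both to be positive, which holds wherever the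
    -- term is nonzero.
    by_contra! hpos
    have hxy : 0 < μX x * μY y := pos_of_mul_pos_left hpos (mul_nonneg hA hB)
    have hx' : 0 < μX x := pos_of_mul_pos_left hxy hy
    have hy' : 0 < μY y := pos_of_mul_pos_right hxy hx
    have hB' : 0 < P.bobWeight y m :=
      pos_of_mul_pos_right (pos_of_mul_pos_right hpos hxy.le) hA
    have havg : 0 < P.bobAvg μY m := (mul_pos hy' hB').trans_le
      (Finset.single_le_sum (f := fun y => μY y * P.bobWeight y m)
        (fun y _ => mul_nonneg (hμY.1 y) (P.bobWeight_nonneg y m)) (Finset.mem_univ y))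
    refine h2 ?_
    have := mul_lt_mul_of_pos_left h1 (mul_pos hx' havg)
    linarith
  · simpa using by positivity
  · exact le_rfl

open Classical in
/-- Bob's likelihood ratio exceeds `2 ^ b` with probability at most `(I(Y : M) + 2) / b`. -/
lemma mul_bob_tail_le (hμX : μX ∈ stdSimplex ℝ X) (hμY : μY ∈ stdSimplex ℝ Y) (b : ℕ) :
    b * (∑ x, ∑ y, μX x * μY y * ∑ m : P.Outcome,
      (if 2 ^ b * P.bobAvg μY m < P.bobWeight y m then
        P.aliceWeight x m * P.bobWeight y m else 0)) ≤ P.privacyLossBob μX μY + 2 := by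
  refine le_trans ?_ (mul_prob_lt_joint_le (P.runDist_mem hμX hμY) (fun ω => ω.2.1) P.transcript b)
  refine mul_le_mul_of_nonneg_left ?_ (Nat.cast_nonneg b)
  rw [P.prob_runDist μX μY (fun _ y t => 2 ^ b * (prob (P.runDist μX μY) (fun ω' => ω'.2.1 = y) *
    prob (P.runDist μX μY) (fun ω' => P.transcript ω' = t)) <
      prob (P.runDist μX μY) (fun ω' => (ω'.2.1, P.transcript ω') = (y, t)))]
  simp_rw [prob_bob_input_transcript, prob_transcript, P.prob_bob_input hμX]
  refine Finset.sum_le_sum fun x _ => Finset.sum_le_sum fun y _ => ?_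
  rw [Finset.mul_sum, Finset.mul_sum]
  refine Finset.sum_le_sum fun m _ => ?_
  have hx := hμX.1 x
  have hy := hμY.1 y
  have hA := P.aliceWeight_nonneg x m
  have hB := P.bobWeight_nonneg y m
  split_ifs with h1 h2 h2
  · exact le_rfl
  · rw [mul_zero]
    by_contra! hpos
    have hxy : 0 < μX x * μY y := pos_of_mul_pos_left hpos (mul_nonneg hA hB)
    have hx' : 0 < μX x := pos_of_mul_pos_left hxy hy
    have hy' : 0 < μY y := pos_of_mul_pos_right hxy hx
    have hA' : 0 < P.aliceWeight x m :=
      pos_of_mul_pos_left (pos_of_mul_pos_right hpos hxy.le) hB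
    have havg : 0 < P.aliceAvg μX m := (mul_pos hx' hA').trans_le
      (Finset.single_le_sum (f := fun x => μX x * P.aliceWeight x m)
        (fun x _ => mul_nonneg (hμX.1 x) (P.aliceWeight_nonneg x m)) (Finset.mem_univ x))
    refine h2 ?_
    have := mul_lt_mul_of_pos_left h1 (mul_pos hy' havg)
    linarith
  · simpa using by positivity
  · exact le_rfl

open Classical in
/-- Bob can choose his answer deterministically from his input and the transcript. -/
lemma exists_answer (f : Set (X × Y × Z)) (μX : X → ℝ) (hμY : ∀ y, 0 ≤ μY y) :
    ∃ z : Y → P.Outcome → Z, ∑ x, ∑ y, μX x * μY y * ∑ m : P.Outcome,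
      P.aliceWeight x m * P.bobWeight y m * (if (x, y, z y m) ∉ f then 1 else 0) ≤
        P.error f μX μY := by
  have hne : Nonempty RB := by
    by_contra h
    rw [not_nonempty_iff] at h
    simpa using P.bobCoins_mem.2
  -- Given `y` and `m`, the weights `μX x * aliceWeight x m` do not involve Bob's coin, so one best
  -- coin is at least as good as their average.
  have hbest : ∀ (y : Y) (m : P.Outcome), ∃ b, ∀ b',
      (∑ x, μX x * P.aliceWeight x m * if (x, y, P.output y b m) ∉ f then 1 else 0) ≤
        ∑ x, μX x * P.aliceWeight x m * if (x, y, P.output y b' m) ∉ f then 1 else 0 :=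
    fun y m => Finite.exists_min _
  choose b hb using hbest
  refine ⟨fun y m => P.output y (b y m) m, ?_⟩
  have h := P.sum_runs μX μY (fun x y t b => if (x, y, P.output y b t) ∉ f then 1 else 0)
  refine le_trans ?_ (le_of_eq (h.symm.trans ?_))
  swap
  · rw [error, prob_eq_sum_ite]
    refine Finset.sum_congr rfl fun ω _ => ?_
    rw [mul_ite, mul_one, mul_zero]
    unfold answer
    congr
  rw [Finset.sum_comm, Finset.sum_comm (γ := X)]
  refine Finset.sum_le_sum fun y _ => ?_
  simp_rw [Finset.mul_sum]
  rw [Finset.sum_comm, Finset.sum_comm (γ := X)]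
  refine Finset.sum_le_sum fun m _ => ?_
  calc _ = μY y * ∑ b', P.bobCoinWeight y m b' * ∑ x, μX x * P.aliceWeight x m *
        (if (x, y, P.output y (b y m) m) ∉ f then 1 else 0) := by
        rw [← Finset.sum_mul, ← bobWeight, Finset.mul_sum, Finset.mul_sum]
        exact Finset.sum_congr rfl fun x _ => by ring
    _ ≤ μY y * ∑ b', P.bobCoinWeight y m b' * ∑ x, μX x * P.aliceWeight x m *
        (if (x, y, P.output y b' m) ∉ f then 1 else 0) := by
        refine mul_le_mul_of_nonneg_left (Finset.sum_le_sum fun b' _ => ?_) (hμY y)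
        exact mul_le_mul_of_nonneg_left (hb y m b') (P.bobCoinWeight_nonneg y m b')
    _ = _ := by
        rw [Finset.sum_comm, Finset.mul_sum]
        refine Finset.sum_congr rfl fun b' _ => ?_
        rw [Finset.mul_sum, Finset.mul_sum]
        exact Finset.sum_congr rfl fun x _ => by ring

end Tails

end PrivateCoinProtocol

/-! ### Parameters and the final bound. -/

/-- The choice of the parameters of the sampling protocol. -/
lemma exists_parameters {δ ka kb : ℝ} (hδ : 0 < δ) (hδ2 : δ < 1 / 2) (hka : 0 ≤ ka)
    (hkb : 0 ≤ kb) : ∃ n a b : ℕ, 0 < n ∧ 0 < a ∧ 0 < b ∧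
      2 * ((ka + 2) / a + (kb + 2) / b) + 2 / n ≤ δ ∧
      ((n * n * 2 ^ b * (n + a + b) : ℕ) : ℝ) ≤ 575 * (Real.logb 2 (1 / δ) / δ ^ 3) * (ka + 1) *
        (2 : ℝ) ^ (34 * ((kb + 1) / δ ^ 2)) := by
  have h1δ : 2 ≤ 1 / δ := by rw [le_div_iff₀ hδ]; linarith
  have ceil : ∀ r : ℝ, 0 < r → 0 < ⌈r⌉₊ ∧ r ≤ ⌈r⌉₊ ∧ (⌈r⌉₊ : ℝ) ≤ r + 1 := fun r hr =>
    ⟨Nat.ceil_pos.mpr hr, Nat.le_ceil r, (Nat.ceil_lt_add_one hr.le).le⟩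
  -- The term `2 / n` takes `δ / 2`, and each tail is at most `δ / 8` before the factor `2`.
  obtain ⟨hn0, hn1, hn2⟩ := ceil (4 / δ) (by positivity)
  obtain ⟨ha0, ha1, ha2⟩ := ceil (8 * (ka + 2) / δ) (by positivity)
  obtain ⟨hb0, hb1, hb2⟩ := ceil (8 * (kb + 2) / δ) (by positivity)
  set n := ⌈4 / δ⌉₊
  set a := ⌈8 * (ka + 2) / δ⌉₊
  set b := ⌈8 * (kb + 2) / δ⌉₊
  refine ⟨n, a, b, hn0, ha0, hb0, ?_, ?_⟩
  · have hn' : (0 : ℝ) < n := by exact_mod_cast hn0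
    have ha' : (0 : ℝ) < a := by exact_mod_cast ha0
    have hb' : (0 : ℝ) < b := by exact_mod_cast hb0
    rw [div_le_iff₀ hδ] at hn1 ha1 hb1
    have h1 : 2 / (n : ℝ) ≤ δ / 2 := by rw [div_le_iff₀ hn']; linarith
    have h2 : (ka + 2) / (a : ℝ) ≤ δ / 8 := by rw [div_le_iff₀ ha']; linarith
    have h3 : (kb + 2) / (b : ℝ) ≤ δ / 8 := by rw [div_le_iff₀ hb']; linarith
    linarith
  · have hn3 : (n : ℝ) ≤ 5 / δ := by
      have : 5 / δ = 4 / δ + 1 / δ := by ring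
      linarith
    have hka' : 0 ≤ ka / δ := by positivity
    have hkb' : 0 ≤ kb / δ := by positivity
    have ha3 : (a : ℝ) ≤ 17 * ((ka + 1) / δ) := by
      have h1 : 17 * ((ka + 1) / δ) = 17 * (ka / δ) + 17 * (1 / δ) := by ring
      have h2 : 8 * (ka + 2) / δ = 8 * (ka / δ) + 16 * (1 / δ) := by ring
      linarith
    have hb3 : (b : ℝ) ≤ 17 * ((kb + 1) / δ) := by
      have h1 : 17 * ((kb + 1) / δ) = 17 * (kb / δ) + 17 * (1 / δ) := by ring
      have h2 : 8 * (kb + 2) / δ = 8 * (kb / δ) + 16 * (1 / δ) := by ring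
      linarith
    have hb4 : (b : ℝ) ≤ 2 ^ b := by exact_mod_cast Nat.lt_two_pow_self.le
    have hb5 : (1 : ℝ) ≤ 2 ^ b := one_le_pow₀ one_le_two
    have hk1 : 1 / δ ≤ (ka + 1) / δ := by gcongr; linarith
    -- Here `23 = 5 + 17 + 1`, where `b ≤ 2 ^ b` absorbs the linear factor; later `575 = 5 * 5 *
    -- 23`.
    have hsum : (n : ℝ) + a + b ≤ 23 * ((ka + 1) / δ) * 2 ^ b := by
      have h5 : (n : ℝ) ≤ 5 * ((ka + 1) / δ) := by
        have : 5 / δ = 5 * (1 / δ) := by ring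
        linarith
      have h6 : ((ka + 1) / δ) * 1 ≤ ((ka + 1) / δ) * 2 ^ b := by gcongr
      have h7 : 1 * (2 : ℝ) ^ b ≤ ((ka + 1) / δ) * 2 ^ b := by gcongr; linarith
      linarith
    have hlog : 1 ≤ Real.logb 2 (1 / δ) := by
      rw [Real.le_logb_iff_rpow_le one_lt_two (by positivity)]
      simpa using h1δ
    -- The exponent `2 * b` is at most `34 * (kb + 1) / δ`; passing to `δ ^ 2` only weakens the
    -- bound.
    have hpow : (2 : ℝ) ^ b * 2 ^ b ≤ (2 : ℝ) ^ (34 * ((kb + 1) / δ ^ 2)) := by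
      rw [← pow_add, ← Real.rpow_natCast]
      refine Real.rpow_le_rpow_of_exponent_le one_le_two ?_
      have h8 : (kb + 1) / δ ≤ (kb + 1) / δ ^ 2 := by
        gcongr
        nlinarith
      push_cast
      linarith
    push_cast
    calc (n : ℝ) * n * 2 ^ b * (n + a + b)
        ≤ (5 / δ) * (5 / δ) * 2 ^ b * (23 * ((ka + 1) / δ) * 2 ^ b) := by gcongr
      _ = 575 * (1 / δ ^ 3) * (ka + 1) * (2 ^ b * 2 ^ b) := by field_simp; ring
      _ ≤ _ := by gcongr

end CommComplexity

theorem mainTheorem5 :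
    ∃ C₁ : ℝ, 0 < C₁ ∧ ∃ C₂ : ℝ, 0 < C₂ ∧
      ∀ (X Y Z RA RB : Type*) [Fintype X] [Fintype Y] [Fintype RA] [Fintype RB]
        (f : Set (X × Y × Z)) (μX : X → ℝ) (μY : Y → ℝ)
        (P : CommComplexity.PrivateCoinProtocol X Y Z RA RB) (ε δ ka kb : ℝ),
        μX ∈ stdSimplex ℝ X → μY ∈ stdSimplex ℝ Y →
        0 < ε → ε < 1 / 2 → 0 < δ → ε + δ < 1 / 2 →
        P.error f μX μY ≤ ε →
        P.privacyLossAlice μX μY ≤ ka →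
        P.privacyLossBob μX μY ≤ kb →
        (∃ (R : Type) (_ : Fintype R) (Q : CommComplexity.OneWayPublicCoinProtocol X Y Z R),
          (Q.cost : ℝ) ≤ C₁ * (Real.logb 2 (1 / δ) / δ ^ 3) * (ka + 1) *
            (2 : ℝ) ^ (C₂ * ((kb + 1) / δ ^ 2)) ∧
          Q.error f μX μY ≤ ε + δ) ∧
        (∃ Q : CommComplexity.OneWayDetProtocol X Y Z,
          (Q.cost : ℝ) ≤ C₁ * (Real.logb 2 (1 / δ) / δ ^ 3) * (ka + 1) *
            (2 : ℝ) ^ (C₂ * ((kb + 1) / δ ^ 2)) ∧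
          Q.error f μX μY ≤ ε + δ) := by
  classical
  refine ⟨575, by norm_num, 34, by norm_num, ?_⟩
  intro X Y Z RA RB _ _ _ _ f μX μY P ε δ ka kb hμX hμY hε _ hδ hεδ herr hka hkb
  have hrun := P.runDist_mem hμX hμY
  -- Real bounds on the privacy losses are automatically nonnegative, as the choice of parameters
  -- needs.
  have hka0 : 0 ≤ ka := (CommComplexity.mutualInfo_nonneg hrun _ _).trans hka
  have hkb0 : 0 ≤ kb := (CommComplexity.mutualInfo_nonneg hrun _ _).trans hkb
  obtain ⟨n, a, b, hn, ha, hb, hδ', hcost⟩ :=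
    CommComplexity.exists_parameters hδ (by linarith) hka0 hkb0
  let _ : Fintype P.Outcome := Fintype.ofFinite _
  have hne : Nonempty P.Outcome := by
    have : Nonempty (X × Y × RA × RB) := by
      by_contra h
      rw [not_nonempty_iff] at h
      simpa using hrun.2
    exact (Set.range_nonempty P.transcript).to_subtype
  obtain ⟨z, hz⟩ := P.exists_answer f μX hμY.1
  have ha' : (0 : ℝ) < a := by exact_mod_cast ha
  have hb' : (0 : ℝ) < b := by exact_mod_cast hb
  have htailA := P.mul_alice_tail_le hμX hμY a
  have htailB := P.mul_bob_tail_le hμX hμY b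
  rw [mul_comm, ← le_div_iff₀ ha'] at htailA
  rw [mul_comm, ← le_div_iff₀ hb'] at htailB
  obtain ⟨Q, hQc, hQe⟩ := CommComplexity.exists_oneWayDetProtocol f hμX hμY
    (A := fun x (m : P.Outcome) => P.aliceWeight x m)
    (B := fun y (m : P.Outcome) => P.bobWeight y m)
    (fun x m => P.aliceWeight_nonneg x m) (fun y m => P.bobWeight_nonneg y m)
    P.sum_aliceWeight_mul_bobWeight z a b hn (hz.trans herr)
    (htailA.trans (b := _) (c := (ka + 2) / a) (by gcongr))
    (htailB.trans (b := _) (c := (kb + 2) / b) (by gcongr))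
  have hQ : Q.error f μX μY ≤ ε + δ := hQe.trans (by linarith)
  rw [← hQc] at hcost
  -- The public-coin protocol is the deterministic one with a trivial coin.
  refine ⟨⟨Unit, inferInstance, ⟨Q.cost, fun _ => 1, ⟨fun _ => zero_le_one, by simp⟩,
    fun x _ => Q.msg x, fun y _ => Q.output y⟩, hcost, ?_⟩, Q, hcost, hQ⟩
  refine le_trans (le_of_eq ?_) hQ
  rw [CommComplexity.OneWayPublicCoinProtocol.error, CommComplexity.OneWayDetProtocol.error,
    CommComplexity.prob_eq_sum_ite, CommComplexity.prob_eq_sum_ite]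
  simp [Fintype.sum_prod_type]
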